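/- Let $d\ge 2$, $\gamma>0$, $\Omega=[-1/2,1/2]^d$, and let $f:\mathbb{R}^d\to\mathbb{C}$ be measurable and vanish outside $\Omega$. Let $\delta_n>0$ satisfy $\lim_n n\,\delta_n^d=\gamma$. For each $n$ let $X_1,\dots,X_n$ be independent random points uniformly distributed on $\Omega$, and let $B_n$ be the $n\times n$ matrix with entries $(B_n)_{ik}=f\big((X_i-X_k)/\delta_n\big)$, $1\le i,k\le n$, with eigenvalues $\lambda_1'(n),\dots,\lambda_n'(n)$. Let $\mathrm{Po}(\gamma)$ denote a Poisson random variable of intensity $\gamma$. For every $n\ge 2$ there is a unique integer $j(n)\ge 0$ with $$n\,\mathbb{P}(\mathrm{Po}(\gamma)\ge j(n)+1)\le 1<n\,\mathbb{P}(\mathrm{Po}(\gamma)\ge j(n)),$$ and, with probability tending to $1$ as $n\to\infty$, $$\max_{1\le i\le n}|\lambda_i'(n)|\le j(n)\,\sup_{x\in\Omega}|f(x)|.$$ Moreover $j(n)\le 3\ln n/\ln\ln n$ for all $n$ large enough; consequently, with probability tending to $1$, $$\max_{1\le i\le n}|\lambda_i'(n)|\le \frac{3\ln n}{\ln\ln n}\,\sup_{x\in\Omega}|f(x)|,$$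 so that, when $f$ is bounded, the spectral radius of $B_n$ is $O(\ln n/\ln\ln n)$ with probability tending to $1$. (If $f$ is unbounded the supremum is $+\infty$.) -/

import Mathlib

open MeasureTheory ProbabilityTheory Filter Topology
open scoped NNReal ENNReal

/-- The hypercube `[-1/2, 1/2]^d`. -/
def unitCube (d : ℕ) : Set (Fin d → ℝ) :=
  {x | ∀ k, -(1 / 2 : ℝ) ≤ x k ∧ x k ≤ 1 / 2}

/-- The Euclidean random matrix `(f_δ (x_i - x_j))_{i,j}`, where `f_δ y = f (y / δ)`. -/
noncomputable def euclideanMatrix {d n : ℕ} (f : (Fin d → ℝ) → ℂ) (δ : ℝ) (x : Fin n → Fin d → ℝ) :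
    Matrix (Fin n) (Fin n) ℂ :=
  Matrix.of fun i j => f (δ⁻¹ • (x i - x j))

/-- `k` solves `n P(Po(γ) ≥ k + 1) ≤ 1 < n P(Po(γ) ≥ k)`. -/
def IsPoissonLevel (γ : ℝ≥0) (n k : ℕ) : Prop :=
  (n : ℝ≥0∞) * poissonMeasure γ (Set.Ici (k + 1)) ≤ 1 ∧
    1 < (n : ℝ≥0∞) * poissonMeasure γ (Set.Ici k)

/-!
Write `window δ y` for the cube of side `δ` centred at `y`. The entry `(i, k)` of the matrix
vanishes unless `x k` lies in the window of `x i`, so the matrix is dominated entrywise by `sup |f|`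
times the adjacency matrix, loops included, of a random geometric graph. The degree of `x i` is
`windowCount δ x i`.

Row sums alone are not enough: the maximal degree may exceed the Poisson level `j`, because the
expected number of vertices of degree larger than `j` need not be small. Instead, the square of the
spectral radius is bounded by the maximal number of two-step paths from a vertex
(`spectralRadius_le_of_sum_card_le`), and that number is at most `j ^ 2` with high probability,
since the neighbours of a vertex of large degree do not all have large degree themselves. With
`ε = κ / log j` for a small constant `κ`, three events are excluded:

* some degree is at least `(1 + ε) * j`;
* two neighbours both have degree at least `(1 - 3 * ε) * j` although one is outside the window of
  side `δ / 2` of the other;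
* some point has degree at least `(1 - 3 * ε) * j`, with at least half as many points in its window
  of side `δ / 2`.

Off these events the count of two-step paths is elementary (`sum_windowCount_le`). Each event has
vanishing probability by a union bound and a Chernoff bound (`measure_windowCount_ge_le`,
`measure_pair_windowCount_ge_le`). Lowering the threshold by `3 * ε * j` costs a factor
`exp (3 * κ * j + o(j))`, and an error of a small relative size `η` in `n * δ ^ d` a factor
`exp (η * j)`. The geometric constraint in the last two events gains a larger exponential factor, as
two windows whose centres are far apart overlap in at most three quarters of their volume, and the
small window has at most a quarter of the volume. In the first event, raising the threshold by
`ε * j` gains `exp (κ * j + o(j))`.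

The comparison with the level `j` uses only
`n ≤ exp γ * (j + 1)! / γ ^ (j + 1)` and Stirling's formula (`tendsto_levelBound`). The bound
`j ≤ 3 log n / log log n` follows from `j! / γ ^ j < n`.
-/

/-! ### Windows and their volumes -/

/-- The cube of side `δ` centred at `y`. The `(i, k)` entry of the Euclidean random matrix can be
nonzero only if `x k` lies in the window of side `δ` around `x i`. -/
def window {d : ℕ} (δ : ℝ) (y : Fin d → ℝ) : Set (Fin d → ℝ) :=
  {z | δ⁻¹ • (y - z) ∈ unitCube d}

lemma mem_window_iff {d : ℕ} {δ : ℝ} (hδ : 0 < δ) {y z : Fin d → ℝ} :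
    z ∈ window δ y ↔ ∀ a, |y a - z a| ≤ δ / 2 := by
  refine forall_congr' fun a => ?_
  simp only [Pi.smul_apply, Pi.sub_apply, smul_eq_mul]
  rw [abs_le, inv_mul_eq_div, le_div_iff₀ hδ, div_le_iff₀ hδ]
  constructor <;> rintro ⟨h1, h2⟩ <;> constructor <;> linarith

lemma self_mem_window {d : ℕ} {δ : ℝ} (hδ : 0 < δ) (y : Fin d → ℝ) : y ∈ window δ y := by
  rw [mem_window_iff hδ]
  intro a
  simp only [sub_self, abs_zero]
  positivity

lemma window_half_subset {d : ℕ} {δ : ℝ} (hδ : 0 < δ) (y : Fin d → ℝ) :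
    window (δ / 2) y ⊆ window δ y := by
  intro z hz
  rw [mem_window_iff hδ]
  rw [mem_window_iff (half_pos hδ)] at hz
  intro a
  linarith [hz a]

lemma window_eq_Icc {d : ℕ} {δ : ℝ} (hδ : 0 < δ) (y : Fin d → ℝ) :
    window δ y = Set.Icc (fun a => y a - δ / 2) (fun a => y a + δ / 2) := by
  ext z
  rw [mem_window_iff hδ]
  simp only [Set.mem_Icc, Pi.le_def, ← forall_and, abs_le]
  refine forall_congr' fun a => ?_
  constructor <;> rintro ⟨h1, h2⟩ <;> constructor <;> linarith

lemma measurableSet_unitCube (d : ℕ) : MeasurableSet (unitCube d) := by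
  have : unitCube d = Set.Icc (fun _ => -(1 / 2 : ℝ)) (fun _ => 1 / 2) := by
    ext x
    simp [unitCube, Pi.le_def, forall_and]
  rw [this]
  exact measurableSet_Icc

lemma measurableSet_window {d : ℕ} {α : Type*} [MeasurableSpace α] (δ : ℝ)
    {g h : α → Fin d → ℝ} (hg : Measurable g) (hh : Measurable h) :
    MeasurableSet {a | h a ∈ window δ (g a)} :=
  ((hg.sub hh).const_smul δ⁻¹) (measurableSet_unitCube d)

lemma measurableSet_window_const {d : ℕ} (δ : ℝ) (y : Fin d → ℝ) : MeasurableSet (window δ y) :=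
  measurableSet_window δ measurable_const measurable_id

lemma volume_window {d : ℕ} {δ : ℝ} (hδ : 0 < δ) (y : Fin d → ℝ) :
    volume (window δ y) = ENNReal.ofReal (δ ^ d) := by
  rw [window_eq_Icc hδ, Real.volume_Icc_pi, ENNReal.ofReal_pow hδ.le]
  simp

lemma volume_unitCube (d : ℕ) : volume (unitCube d) = 1 := by
  have h : unitCube d = window 1 0 := by
    ext z
    rw [mem_window_iff one_pos]
    simp only [unitCube, Set.mem_ofPred_eq, Pi.zero_apply, zero_sub, abs_neg, abs_le]
  rw [h, volume_window one_pos]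
  simp

/-- Two windows whose centres are more than `δ / 4` apart in some coordinate share at most
three quarters of their volume. -/
lemma volume_window_inter_le {d : ℕ} {δ : ℝ} (hδ : 0 < δ) {y y' : Fin d → ℝ}
    (h : y' ∉ window (δ / 2) y) :
    volume (window δ y ∩ window δ y') ≤ ENNReal.ofReal (3 / 4 * δ ^ d) := by
  rw [mem_window_iff (half_pos hδ)] at h
  push Not at h
  obtain ⟨a, ha⟩ := h
  rw [window_eq_Icc hδ, window_eq_Icc hδ, Set.Icc_inter_Icc, Real.volume_Icc_pi]
  calc _ ≤ ∏ b, ENNReal.ofReal (if b = a then 3 / 4 * δ else δ) := by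
        refine Finset.prod_le_prod' fun b _ => ENNReal.ofReal_le_ofReal ?_
        simp only [Pi.inf_apply, Pi.sup_apply]
        split_ifs with hb
        · subst hb
          rcases le_total (y b) (y' b) with hyy | hyy
          · rw [abs_of_nonpos (by linarith)] at ha
            linarith [inf_le_left (a := y b + δ / 2) (b := y' b + δ / 2),
              le_sup_right (a := y b - δ / 2) (b := y' b - δ / 2)]
          · rw [abs_of_nonneg (by linarith)] at ha
            linarith [inf_le_right (a := y b + δ / 2) (b := y' b + δ / 2),
              le_sup_left (a := y b - δ / 2) (b := y' b - δ / 2)]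
        · linarith [inf_le_left (a := y b + δ / 2) (b := y' b + δ / 2),
            le_sup_left (a := y b - δ / 2) (b := y' b - δ / 2)]
    _ = ENNReal.ofReal (∏ b, if b = a then 3 / 4 * δ else δ) := by
        rw [ENNReal.ofReal_prod_of_nonneg]
        intro b _
        split_ifs <;> positivity
    _ = _ := by
        congr 1
        have : ∀ b, (if b = a then 3 / 4 * δ else δ) = (if b = a then 3 / 4 else 1) * δ := by
          intro b; split_ifs <;> ring
        simp_rw [this, Finset.prod_mul_distrib]
        simp

/-! ### Chernoff bounds for window counts -/

/-- Tonelli's theorem for independent points: conditionally on the points indexed by `S`, the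
remaining ones contribute independent factors. -/
lemma lintegral_mul_prod_compl_le {ι E : Type*} [Fintype ι] [DecidableEq ι] [MeasurableSpace E]
    (μ : Measure E) [IsProbabilityMeasure μ] (S : Finset ι)
    (φ : (S → E) → ℝ≥0∞) (hφ : Measurable φ)
    (G : (S → E) → ι → E → ℝ≥0∞) (hG : ∀ l, Measurable fun q : (S → E) × E => G q.1 l q.2)
    (c : ι → ℝ≥0∞) (hc : ∀ a l, φ a ≠ 0 → ∫⁻ z, G a l z ∂μ ≤ c l) :
    ∫⁻ x, φ (fun i => x i) * ∏ l ∈ Sᶜ, G (fun i => x i) l (x l) ∂(Measure.pi fun _ : ι => μ) ≤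
      (∫⁻ x, φ (fun i => x i) ∂(Measure.pi fun _ : ι => μ)) * ∏ l ∈ Sᶜ, c l := by
  have hmp := measurePreserving_piEquivPiSubtypeProd (fun _ : ι => μ) (fun i => i ∈ S)
  have hsub : ∀ g : ι → ℝ≥0∞, ∏ l ∈ Sᶜ, g l = ∏ l : {l // l ∉ S}, g l := fun g =>
    Finset.prod_subtype _ (by simp) _
  have hGa : ∀ (a : S → E) l, Measurable (G a l) := fun a l =>
    (hG l).comp (measurable_const.prodMk measurable_id)
  have h1 := hmp.lintegral_comp_emb (MeasurableEquiv.measurableEmbedding _)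
    (fun q : ({i // i ∈ S} → E) × ({i // i ∉ S} → E) => φ q.1 * ∏ l : {l // l ∉ S}, G q.1 l (q.2 l))
  have h2 := hmp.lintegral_comp_emb (MeasurableEquiv.measurableEmbedding _)
    (fun q : ({i // i ∈ S} → E) × ({i // i ∉ S} → E) => φ q.1)
  simp_rw [hsub]
  have e1 : ∫⁻ x, φ (fun i => x i) * ∏ l : {l // l ∉ S}, G (fun i => x i) l (x l)
      ∂(Measure.pi fun _ : ι => μ) = _ := h1
  have e2 : ∫⁻ x, φ (fun i => x i) ∂(Measure.pi fun _ : ι => μ) = _ := h2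
  rw [e1, e2, lintegral_prod _ (by fun_prop), lintegral_prod _ (by fun_prop)]
  simp only [lintegral_const, measure_univ, mul_one]
  rw [← lintegral_mul_const _ hφ]
  refine lintegral_mono fun a => ?_
  simp only
  rw [lintegral_const_mul _ (by fun_prop)]
  by_cases h0 : φ a = 0
  · simp [h0]
  gcongr
  have hind := iIndepFun_pi (μ := fun _ : {l // l ∉ S} => μ) (X := fun l => G a l)
    (fun l => (hGa a l).aemeasurable)
  rw [lintegral_prod_eq_prod_lintegral_of_indepFun _ _ hind
    (fun l => (hGa a l).comp (measurable_pi_apply l))]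
  refine Finset.prod_le_prod' fun l _ => ?_
  rw [(measurePreserving_eval (fun _ : {l // l ∉ S} => μ) l).lintegral_comp (hGa a l)]
  exact hc a l h0

open Classical in
/-- The number of points `x k`, the point `x i` included, in the window of side `δ` around
`x i`. -/
noncomputable def windowCount {d n : ℕ} (δ : ℝ) (x : Fin n → Fin d → ℝ) (i : Fin n) : ℕ :=
  (Finset.univ.filter fun k => x k ∈ window δ (x i)).card

open Classical in
lemma prod_ite_mem_window {d n : ℕ} (δ T : ℝ) (x : Fin n → Fin d → ℝ) (i : Fin n) :
    ∏ l, (if x l ∈ window δ (x i) then T else 1) = T ^ windowCount δ x i := by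
  rw [Finset.prod_ite]
  simp [windowCount]

/-- The bound `1 + t ≤ exp t` for the integral of a two-step weight function. -/
lemma lintegral_ofReal_le_exp {E : Type*} [MeasurableSpace E] (μ : Measure E)
    [IsProbabilityMeasure μ] {g : E → ℝ} {A B : Set E} (hA : MeasurableSet A)
    (hB : MeasurableSet B) {a b α β : ℝ} (ha : 0 ≤ a) (hb : 0 ≤ b) (hα : 0 ≤ α) (hβ : 0 ≤ β)
    (hμA : μ A ≤ ENNReal.ofReal α) (hμB : μ B ≤ ENNReal.ofReal β)
    (hg : ∀ z, g z ≤ 1 + A.indicator (fun _ => a) z + B.indicator (fun _ => b) z) :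
    ∫⁻ z, ENNReal.ofReal (g z) ∂μ ≤ ENNReal.ofReal (Real.exp (a * α + b * β)) := by
  calc ∫⁻ z, ENNReal.ofReal (g z) ∂μ
      ≤ ∫⁻ z, (1 + A.indicator (fun _ => ENNReal.ofReal a) z
          + B.indicator (fun _ => ENNReal.ofReal b) z) ∂μ := by
        refine lintegral_mono fun z => (ENNReal.ofReal_le_ofReal (hg z)).trans ?_
        by_cases h1 : z ∈ A <;> by_cases h2 : z ∈ B <;>
          simp [h1, h2, ENNReal.ofReal_add, ha, hb, add_nonneg]
    _ = 1 + ENNReal.ofReal a * μ A + ENNReal.ofReal b * μ B := by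
        rw [lintegral_add_right _ (measurable_const.indicator hB),
          lintegral_add_right _ (measurable_const.indicator hA)]
        simp [hA, hB]
    _ ≤ 1 + ENNReal.ofReal a * ENNReal.ofReal α + ENNReal.ofReal b * ENNReal.ofReal β := by
        gcongr
    _ = ENNReal.ofReal (a * α + b * β + 1) := by
        rw [← ENNReal.ofReal_mul ha, ← ENNReal.ofReal_mul hb, ← ENNReal.ofReal_one,
          ← ENNReal.ofReal_add (by positivity) (by positivity),
          ← ENNReal.ofReal_add (by positivity) (by positivity)]
        congr 1; ring
    _ ≤ _ := ENNReal.ofReal_le_ofReal (Real.add_one_le_exp _)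

lemma prod_ofReal_exp_le {n : ℕ} (S : Finset (Fin n)) {t : ℝ} (ht : 0 ≤ t) :
    ∏ _l ∈ S, ENNReal.ofReal (Real.exp t) ≤ ENNReal.ofReal (Real.exp (n * t)) := by
  rw [Finset.prod_const, ← ENNReal.ofReal_pow (Real.exp_pos _).le, ← Real.exp_nat_mul]
  have : S.card ≤ n := by simpa using Finset.card_le_univ S
  gcongr

lemma rpow_neg_mul_pow_ge_one {T m : ℝ} {k : ℕ} (hT : 1 ≤ T) (h : m ≤ k) :
    1 ≤ T ^ (-m) * T ^ k := by
  rw [← Real.rpow_natCast, ← Real.rpow_add (by linarith)]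
  exact Real.one_le_rpow hT (by linarith)

lemma measure_window_le {d : ℕ} (μ : Measure (Fin d → ℝ)) (hμ : μ ≤ volume) {δ : ℝ} (hδ : 0 < δ)
    (y : Fin d → ℝ) :
    μ (window δ y) ≤ ENNReal.ofReal (δ ^ d) :=
  (hμ _).trans (volume_window hδ y).le

lemma measure_window_half_le {d : ℕ} (μ : Measure (Fin d → ℝ)) (hd : 2 ≤ d) (hμ : μ ≤ volume)
    {δ : ℝ} (hδ : 0 < δ) (y : Fin d → ℝ) : μ (window (δ / 2) y) ≤ ENNReal.ofReal (δ ^ d / 4) := by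
  refine (measure_window_le μ hμ (half_pos hδ) y).trans (ENNReal.ofReal_le_ofReal ?_)
  rw [div_pow]
  have : (2 : ℝ) ^ 2 ≤ 2 ^ d := pow_le_pow_right₀ (by norm_num) hd
  gcongr
  linarith

open Classical in
/-- Chernoff bound for a window containing many points, many of which lie in the window of half
the side: the weight `T` marks the points of the large window, the weight `u` those of the small
one. -/
lemma measure_windowCount_ge_le {d n : ℕ} (μ : Measure (Fin d → ℝ))
    [IsProbabilityMeasure μ] (hd : 2 ≤ d) (hμ : μ ≤ volume) {δ : ℝ} (hδ : 0 < δ) {T u : ℝ}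
    (hT : 1 ≤ T) (hu : 1 ≤ u) (m m' : ℝ) (i : Fin n) :
    Measure.pi (fun _ : Fin n => μ)
        {x | m ≤ windowCount δ x i ∧ m' ≤ windowCount (δ / 2) x i} ≤
      ENNReal.ofReal (T ^ (-m) * u ^ (-m') * (T * u) *
        Real.exp (n * (T * δ ^ d + T * (u - 1) * (δ ^ d / 4)))) := by
  have hT0 : 0 < T := by linarith
  have hu0 : 0 < u := by linarith
  -- `∏ l, w (x i) (x l)` equals `T ^ windowCount δ x i * u ^ windowCount (δ / 2) x i`.
  set w : (Fin d → ℝ) → (Fin d → ℝ) → ℝ := fun y z =>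
    (if z ∈ window δ y then T else 1) * (if z ∈ window (δ / 2) y then u else 1) with hw
  have hw0 : ∀ y z, 0 ≤ w y z := fun y z => by
    simp only [hw]; split_ifs <;> positivity
  have hwm : ∀ {α : Type} [MeasurableSpace α] {g h : α → Fin d → ℝ}, Measurable g →
      Measurable h → Measurable fun a => w (g a) (h a) := by
    intro α _ g h hg hh
    exact (Measurable.ite (measurableSet_window δ hg hh) measurable_const measurable_const).mul
      (Measurable.ite (measurableSet_window _ hg hh) measurable_const measurable_const)
  have hprod : ∀ x : Fin n → Fin d → ℝ,
      ∏ l, w (x i) (x l) = T ^ windowCount δ x i * u ^ windowCount (δ / 2) x i := by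
    intro x
    simp only [hw, Finset.prod_mul_distrib, prod_ite_mem_window]
  set C : ℝ := T ^ (-m) * u ^ (-m') with hC
  have hC0 : 0 ≤ C := by positivity
  have hself : ∀ y, w y y = T * u := fun y => by
    simp [hw, self_mem_window hδ, self_mem_window (half_pos hδ)]
  have hFm : Measurable fun x : Fin n → Fin d → ℝ => ENNReal.ofReal (C * ∏ l, w (x i) (x l)) := by
    refine (measurable_const.mul (Finset.measurable_prod _ fun l _ => ?_)).ennreal_ofReal
    exact hwm (measurable_pi_apply i) (measurable_pi_apply l)
  have hmarkov := mul_meas_ge_le_lintegral (μ := Measure.pi fun _ : Fin n => μ) hFm 1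
  rw [one_mul] at hmarkov
  refine (measure_mono ?_).trans (hmarkov.trans ?_)
  · rintro x ⟨h1, h2⟩
    simp only [Set.mem_ofPred_eq]
    rw [← ENNReal.ofReal_one]
    refine ENNReal.ofReal_le_ofReal ?_
    rw [hprod, hC, mul_mul_mul_comm]
    exact one_le_mul_of_one_le_of_one_le (rpow_neg_mul_pow_ge_one hT h1)
      (rpow_neg_mul_pow_ge_one hu h2)
  have hsplit : ∀ x : Fin n → Fin d → ℝ, ENNReal.ofReal (C * ∏ l, w (x i) (x l)) =
      ENNReal.ofReal (C * (T * u)) * ∏ l ∈ ({i} : Finset (Fin n))ᶜ,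
        ENNReal.ofReal (w (x i) (x l)) := by
    intro x
    rw [Fintype.prod_eq_mul_prod_compl i, hself, ← mul_assoc, ENNReal.ofReal_mul (by positivity),
      ENNReal.ofReal_prod_of_nonneg fun l _ => hw0 _ _]
  simp_rw [hsplit]
  have key := lintegral_mul_prod_compl_le μ ({i} : Finset (Fin n))
    (fun _ => ENNReal.ofReal (C * (T * u))) measurable_const
    (fun a _ z => ENNReal.ofReal (w (a ⟨i, Finset.mem_singleton_self i⟩) z))
    (fun l => (hwm (by fun_prop) (by fun_prop)).ennreal_ofReal)
    (fun _ => ENNReal.ofReal (Real.exp (T * δ ^ d + T * (u - 1) * (δ ^ d / 4)))) ?_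
  · refine key.trans ?_
    simp only [lintegral_const, measure_univ, mul_one]
    rw [ENNReal.ofReal_mul (q := Real.exp _) (by positivity)]
    gcongr
    refine prod_ofReal_exp_le _ ?_
    have : 0 ≤ u - 1 := by linarith
    positivity
  · intro a l _
    refine lintegral_ofReal_le_exp μ
      (measurableSet_window_const δ (a ⟨i, Finset.mem_singleton_self i⟩))
      (measurableSet_window_const (δ / 2) (a ⟨i, Finset.mem_singleton_self i⟩)) hT0.le
      (mul_nonneg hT0.le (by linarith)) (by positivity) (by positivity)
      (measure_window_le μ hμ hδ _) (measure_window_half_le μ hd hμ hδ _) fun z => ?_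
    have hsub := @window_half_subset d δ hδ (a ⟨i, Finset.mem_singleton_self i⟩) z
    simp only [hw, Set.indicator]
    split_ifs <;> nlinarith

lemma measure_mem_window_le {d n : ℕ} (μ : Measure (Fin d → ℝ))
    [IsProbabilityMeasure μ] (hμ : μ ≤ volume) {δ : ℝ} (hδ : 0 < δ) {i k : Fin n} (hik : i ≠ k) :
    Measure.pi (fun _ : Fin n => μ) {x | x k ∈ window δ (x i)} ≤ ENNReal.ofReal (δ ^ d) := by
  classical
  have key := lintegral_mul_prod_compl_le μ ({i} : Finset (Fin n)) (fun _ => 1) measurable_const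
    (fun a l z => if l = k then
      (window δ (a ⟨i, Finset.mem_singleton_self i⟩)).indicator (fun _ => (1 : ℝ≥0∞)) z else 1)
    (fun l => ?_) (fun l => if l = k then ENNReal.ofReal (δ ^ d) else 1) ?_
  · have hk : k ∈ ({i} : Finset (Fin n))ᶜ := by simp [hik.symm]
    simp only [one_mul, lintegral_const, measure_univ] at key
    rw [Finset.prod_ite_eq' _ k fun _ => ENNReal.ofReal (δ ^ d), if_pos hk] at key
    have hm : MeasurableSet {x : Fin n → Fin d → ℝ | x k ∈ window δ (x i)} :=
      measurableSet_window δ (measurable_pi_apply i) (measurable_pi_apply k)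
    rw [← lintegral_indicator_one hm]
    refine le_trans (lintegral_mono fun x => ?_) key
    rw [Finset.prod_ite_eq' _ k fun l => (window δ (x i)).indicator (fun _ => (1 : ℝ≥0∞)) (x l),
      if_pos hk]
    simp [Set.indicator]
  · by_cases h : l = k
    · simp only [h, if_true]
      exact Measurable.ite (measurableSet_window δ (g := fun q : (_ → _) × _ => q.1 _)
        (by fun_prop) measurable_snd) measurable_const measurable_const
    · simp only [h, if_false]
      exact measurable_const
  · intro a l _
    by_cases h : l = k
    · simp only [h, if_true]
      rw [lintegral_indicator_const (measurableSet_window_const δ _),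
        one_mul]
      exact measure_window_le μ hμ hδ _
    · simp [h]

open Classical in
/-- Chernoff bound for two neighbouring points which both have many neighbours although they are
not close: their windows overlap in at most three quarters of the volume of one of them. -/
lemma measure_pair_windowCount_ge_le {d n : ℕ} (μ : Measure (Fin d → ℝ))
    [IsProbabilityMeasure μ] (hμ : μ ≤ volume) {δ : ℝ} (hδ : 0 < δ) {T : ℝ}
    (hT : 1 ≤ T) (m : ℝ) (i k : Fin n) :
    Measure.pi (fun _ : Fin n => μ)
        {x | x k ∈ window δ (x i) ∧ x k ∉ window (δ / 2) (x i) ∧ m ≤ windowCount δ x i ∧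
          m ≤ windowCount δ x k} ≤
      ENNReal.ofReal (δ ^ d * (T ^ (-m) * T ^ (-m) * T ^ 4) *
        Real.exp (n * (T ^ 2 * (3 / 4 * δ ^ d) + T * (2 * δ ^ d)))) := by
  have hT0 : 0 < T := by linarith
  rcases eq_or_ne i k with rfl | hik
  · have : {x : Fin n → Fin d → ℝ | x i ∈ window δ (x i) ∧ x i ∉ window (δ / 2) (x i) ∧
        m ≤ windowCount δ x i ∧ m ≤ windowCount δ x i} = ∅ := by
      ext x
      simp [self_mem_window (half_pos hδ)]
    rw [this]
    simp
  set v : (Fin d → ℝ) → (Fin d → ℝ) → ℝ := fun y z => if z ∈ window δ y then T else 1 with hv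
  have hv0 : ∀ y z, 0 ≤ v y z := fun y z => by
    simp only [hv]; split_ifs <;> positivity
  have hvT : ∀ y z, v y z ≤ T := fun y z => by
    simp only [hv]; split_ifs <;> linarith
  have hvm : ∀ {α : Type} [MeasurableSpace α] {g h : α → Fin d → ℝ}, Measurable g →
      Measurable h → Measurable fun a => v (g a) (h a) := by
    intro α _ g h hg hh
    exact Measurable.ite (measurableSet_window δ hg hh) measurable_const measurable_const
  set C : ℝ := T ^ (-m) * T ^ (-m) with hC
  have hC0 : 0 ≤ C := by positivity
  set A : Set ((Fin d → ℝ) × (Fin d → ℝ)) :=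
    {q | q.2 ∈ window δ q.1 ∧ q.2 ∉ window (δ / 2) q.1} with hA
  have hAm : MeasurableSet A :=
    (measurableSet_window δ measurable_fst measurable_snd).inter
      (measurableSet_window _ measurable_fst measurable_snd).compl
  set S : Finset (Fin n) := {i, k} with hS
  have hi : i ∈ S := by simp [hS]
  have hk : k ∈ S := by simp [hS]
  -- `F` majorizes the indicator of the event; in it the weights of `i` and `k` are replaced by
  -- `T ^ 4`, so that given `x i` and `x k` only independent factors remain.
  set φ : (S → Fin d → ℝ) → ℝ≥0∞ := fun a =>
    A.indicator (fun _ => ENNReal.ofReal (C * T ^ 4)) (a ⟨i, hi⟩, a ⟨k, hk⟩) with hφ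
  have hφm : Measurable φ := (measurable_const.indicator hAm).comp (by fun_prop)
  have hGm : ∀ {α : Type} [MeasurableSpace α] {g g' h : α → Fin d → ℝ}, Measurable g →
      Measurable g' → Measurable h →
      Measurable fun a => ENNReal.ofReal (v (g a) (h a) * v (g' a) (h a)) := by
    intro α _ g g' h hg hg' hh
    exact ((hvm hg hh).mul (hvm hg' hh)).ennreal_ofReal
  set F : (Fin n → Fin d → ℝ) → ℝ≥0∞ := fun x => φ (fun j => x j) *
    ∏ l ∈ Sᶜ, ENNReal.ofReal (v (x i) (x l) * v (x k) (x l)) with hF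
  have hrestr : Measurable fun (x : Fin n → Fin d → ℝ) (j : S) => x j :=
    measurable_pi_lambda _ fun j => measurable_pi_apply _
  have hFm : Measurable F :=
    (hφm.comp hrestr).mul (Finset.measurable_prod _ fun l _ =>
      hGm (measurable_pi_apply i) (measurable_pi_apply k) (measurable_pi_apply l))
  have hmarkov := mul_meas_ge_le_lintegral (μ := Measure.pi fun _ : Fin n => μ) hFm 1
  rw [one_mul] at hmarkov
  refine (measure_mono ?_).trans (hmarkov.trans ?_)
  · rintro x ⟨h1, h2, h3, h4⟩
    have hxA : (x i, x k) ∈ A := ⟨h1, h2⟩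
    have hSle : ∏ l ∈ S, (v (x i) (x l) * v (x k) (x l)) ≤ T ^ 4 := by
      rw [hS, Finset.prod_pair hik]
      calc _ ≤ (T * T) * (T * T) := by
            have hle : ∀ l, v (x i) (x l) * v (x k) (x l) ≤ T * T := fun l =>
              mul_le_mul (hvT _ _) (hvT _ _) (hv0 _ _) hT0.le
            exact mul_le_mul (hle i) (hle k) (mul_nonneg (hv0 _ _) (hv0 _ _)) (by positivity)
        _ = _ := by ring
    simp only [Set.mem_ofPred_eq, hF, hφ]
    rw [Set.indicator_of_mem hxA, ← ENNReal.ofReal_prod_of_nonneg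
      (fun l _ => mul_nonneg (hv0 _ _) (hv0 _ _)), ← ENNReal.ofReal_mul (by positivity),
      ← ENNReal.ofReal_one]
    refine ENNReal.ofReal_le_ofReal ?_
    calc (1 : ℝ) ≤ C * ∏ l, (v (x i) (x l) * v (x k) (x l)) := by
          simp only [hv, Finset.prod_mul_distrib, prod_ite_mem_window]
          rw [hC, mul_mul_mul_comm]
          exact one_le_mul_of_one_le_of_one_le (rpow_neg_mul_pow_ge_one hT h3)
            (rpow_neg_mul_pow_ge_one hT h4)
      _ = C * ((∏ l ∈ S, (v (x i) (x l) * v (x k) (x l))) *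
            ∏ l ∈ Sᶜ, (v (x i) (x l) * v (x k) (x l))) := by
          rw [Finset.prod_mul_prod_compl]
      _ ≤ C * (T ^ 4 * ∏ l ∈ Sᶜ, (v (x i) (x l) * v (x k) (x l))) := by
          refine mul_le_mul_of_nonneg_left (mul_le_mul_of_nonneg_right hSle ?_) hC0
          exact Finset.prod_nonneg fun l _ => mul_nonneg (hv0 _ _) (hv0 _ _)
      _ = _ := by ring
  have key := lintegral_mul_prod_compl_le μ S φ hφm
    (fun a _ z => ENNReal.ofReal (v (a ⟨i, hi⟩) z * v (a ⟨k, hk⟩) z))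
    (fun l => hGm (by fun_prop) (by fun_prop) measurable_snd)
    (fun _ => ENNReal.ofReal (Real.exp (T ^ 2 * (3 / 4 * δ ^ d) + T * (2 * δ ^ d)))) ?_
  · refine key.trans ?_
    rw [ENNReal.ofReal_mul (q := Real.exp _) (by positivity)]
    refine mul_le_mul' ?_ (prod_ofReal_exp_le _ (by positivity))
    have hm : MeasurableSet {x : Fin n → Fin d → ℝ | x k ∈ window δ (x i)} :=
      measurableSet_window δ (measurable_pi_apply i) (measurable_pi_apply k)
    calc _ ≤ ∫⁻ x, {x : Fin n → Fin d → ℝ | x k ∈ window δ (x i)}.indicator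
            (fun _ => ENNReal.ofReal (C * T ^ 4)) x ∂(Measure.pi fun _ : Fin n => μ) := by
          refine lintegral_mono fun x => ?_
          simp only [hφ]
          by_cases h : (x i, x k) ∈ A
          · have hx : x ∈ {x : Fin n → Fin d → ℝ | x k ∈ window δ (x i)} := h.1
            rw [Set.indicator_of_mem h, Set.indicator_of_mem hx]
          · rw [Set.indicator_of_notMem h]
            exact zero_le
      _ ≤ ENNReal.ofReal (C * T ^ 4) * ENNReal.ofReal (δ ^ d) := by
          rw [lintegral_indicator_const hm]
          gcongr
          exact measure_mem_window_le μ hμ hδ hik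
      _ = _ := by
          rw [← ENNReal.ofReal_mul (by positivity)]
          congr 1
          ring
  · intro a l ha
    have haA : (a ⟨i, hi⟩, a ⟨k, hk⟩) ∈ A := by
      by_contra h
      exact ha (Set.indicator_of_notMem h _)
    have hW : ∀ y : Fin d → ℝ, MeasurableSet (window δ y) := measurableSet_window_const δ
    -- The weight is `T ^ 2` on the intersection and `T` on the rest of the union of the windows.
    refine lintegral_ofReal_le_exp μ ((hW (a ⟨i, hi⟩)).inter (hW (a ⟨k, hk⟩)))
      ((hW (a ⟨i, hi⟩)).union (hW (a ⟨k, hk⟩))) (by positivity) hT0.le (by positivity)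
      (by positivity) ((hμ _).trans (volume_window_inter_le hδ haA.2)) ?_ fun z => ?_
    · refine (measure_union_le _ _).trans ((add_le_add (measure_window_le μ hμ hδ _)
        (measure_window_le μ hμ hδ _)).trans ?_)
      rw [← ENNReal.ofReal_add (by positivity) (by positivity), two_mul]
    · by_cases h1 : z ∈ window δ (a ⟨i, hi⟩) <;> by_cases h2 : z ∈ window δ (a ⟨k, hk⟩) <;>
        simp [hv, h1, h2] <;> nlinarith

/-! ### Two-step paths and the spectral radius -/

open Classical in
/-- If few points have an exceptionally large window and these are scarce in every large window,
then every point is the start of at most `J ^ 2` two-step paths. With `s = (1 - 3 * ε) * J` and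
`D = (1 + ε) * J`, at most half of the points in a large window (one with at least `s` points)
have themselves a large window, which outweighs the excess of `D` over `J`. -/
lemma sum_windowCount_le {d n : ℕ} {δ : ℝ} {x : Fin n → Fin d → ℝ} {J ε : ℝ}
    (hJ : 0 ≤ J) (hε : 0 ≤ ε) (hε1 : 3 * ε ≤ 1)
    (h1 : ∀ i, windowCount δ x i < (1 + ε) * J)
    (h2 : ∀ i k, x k ∈ window δ (x i) → (1 - 3 * ε) * J ≤ windowCount δ x i →
      (1 - 3 * ε) * J ≤ windowCount δ x k → x k ∈ window (δ / 2) (x i))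
    (h3 : ∀ i, (1 - 3 * ε) * J ≤ windowCount δ x i →
      windowCount (δ / 2) x i < (1 - 3 * ε) * J / 2) (i : Fin n) :
    ∑ k with x k ∈ window δ (x i), (windowCount δ x k : ℝ) ≤ J ^ 2 := by
  have hε0 : 0 ≤ 1 - 3 * ε := by linarith
  have hs0 : 0 ≤ (1 - 3 * ε) * J := by positivity
  rcases lt_or_ge (windowCount δ x i : ℝ) ((1 - 3 * ε) * J) with hlow | hhigh
  · calc ∑ k with x k ∈ window δ (x i), (windowCount δ x k : ℝ)
        ≤ ∑ k with x k ∈ window δ (x i), (1 + ε) * J := Finset.sum_le_sum fun k _ => (h1 k).le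
      _ = windowCount δ x i * ((1 + ε) * J) := by simp [windowCount]
      _ ≤ ((1 - 3 * ε) * J) * ((1 + ε) * J) := by gcongr
      _ ≤ J ^ 2 := by
        nlinarith [mul_nonneg hε (sq_nonneg J), mul_nonneg (sq_nonneg ε) (sq_nonneg J)]
  · have hterm : ∀ k ∈ Finset.univ.filter (fun k => x k ∈ window δ (x i)),
        (windowCount δ x k : ℝ) ≤ (1 - 3 * ε) * J +
          if x k ∈ window (δ / 2) (x i) then 4 * ε * J else 0 := by
      intro k hk
      have hk' := (Finset.mem_filter.1 hk).2
      by_cases hc : (1 - 3 * ε) * J ≤ windowCount δ x k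
      · rw [if_pos (h2 i k hk' hhigh hc)]
        linarith [h1 k]
      · have : 0 ≤ 4 * ε * J := by positivity
        split_ifs <;> linarith
    have hnear : ∑ k with x k ∈ window δ (x i),
        (if x k ∈ window (δ / 2) (x i) then 4 * ε * J else 0) ≤
          windowCount (δ / 2) x i * (4 * ε * J) := by
      calc _ ≤ ∑ k, (if x k ∈ window (δ / 2) (x i) then 4 * ε * J else 0) := by
            refine Finset.sum_le_sum_of_subset_of_nonneg (Finset.filter_subset _ _) fun k _ _ => ?_
            split_ifs <;> positivity
        _ = _ := by rw [← Finset.sum_filter]; simp [windowCount]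
    calc ∑ k with x k ∈ window δ (x i), (windowCount δ x k : ℝ)
        ≤ windowCount δ x i * ((1 - 3 * ε) * J) + windowCount (δ / 2) x i * (4 * ε * J) := by
          refine (Finset.sum_le_sum hterm).trans ?_
          rw [Finset.sum_add_distrib]
          refine add_le_add (le_of_eq ?_) hnear
          simp [windowCount]
      _ ≤ ((1 + ε) * J) * ((1 - 3 * ε) * J) + ((1 - 3 * ε) * J / 2) * (4 * ε * J) := by
          have := h1 i
          have := h3 i hhigh
          gcongr
      _ ≤ J ^ 2 := by nlinarith [mul_nonneg (sq_nonneg ε) (sq_nonneg J)]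

open Classical in
/-- A row-sum bound for the square of a matrix dominated by `M` times the adjacency matrix of a
relation `r`: the spectral radius is at most `M * J` if every index starts at most `J ^ 2` paths
of length two. -/
lemma spectralRadius_le_of_sum_card_le {n : ℕ} (B : Matrix (Fin n) (Fin n) ℂ)
    (r : Fin n → Fin n → Prop) {M J : ℝ≥0} (hB : ∀ i k, ‖B i k‖ ≤ if r i k then (M : ℝ) else 0)
    (hr : ∀ i, ∑ k with r i k, ((Finset.univ.filter (r k)).card : ℝ) ≤ (J : ℝ) ^ 2) :
    spectralRadius ℂ B ≤ J * M := by
  refine iSup₂_le fun z hz => ?_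
  rw [← Matrix.spectrum_toLin', ← Module.End.hasEigenvalue_iff_mem_spectrum] at hz
  obtain ⟨v, hv⟩ := hz.exists_hasEigenvector
  have hvB : ∀ i, z * v i = ∑ k, B i k * v k := fun i => by
    have := congrFun hv.apply_eq_smul i
    simpa [Matrix.toLin'_apply, Matrix.mulVec, dotProduct] using this.symm
  obtain ⟨i₁, hi₁⟩ := Function.ne_iff.1 hv.2
  -- Two applications of the eigenvalue equation at a coordinate where `‖v i‖` is maximal.
  obtain ⟨i, -, hi⟩ := Finset.exists_max_image Finset.univ (fun i => ‖v i‖) ⟨i₁, Finset.mem_univ _⟩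
  have hpos : 0 < ‖v i‖ := (norm_pos_iff.2 hi₁).trans_le (hi i₁ (Finset.mem_univ _))
  have hrow : ∀ k (c : Fin n → ℝ), (∀ l, ‖v l‖ ≤ c l) →
      ‖z‖ * ‖v k‖ ≤ M * ∑ l with r k l, c l := by
    intro k c hc
    rw [← norm_mul, hvB, Finset.mul_sum, Finset.sum_filter]
    refine (norm_sum_le _ _).trans (Finset.sum_le_sum fun l _ => ?_)
    rw [norm_mul]
    have h := hB k l
    split_ifs with hkl
    · rw [if_pos hkl] at h
      exact mul_le_mul h (hc l) (norm_nonneg _) M.2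
    · rw [if_neg hkl] at h
      rw [le_antisymm h (norm_nonneg _), zero_mul]
  have hone : ∀ k, ‖z‖ * ‖v k‖ ≤ M * ((Finset.univ.filter (r k)).card * ‖v i‖) := by
    intro k
    simpa using hrow k (fun _ => ‖v i‖) fun l => hi l (Finset.mem_univ _)
  have hsq : ‖z‖ ^ 2 ≤ ((J : ℝ) * M) ^ 2 := by
    rcases (norm_nonneg z).eq_or_lt with h0 | h0
    · rw [← h0, zero_pow two_ne_zero]
      positivity
    have h2 := hrow i (fun k => ‖z‖⁻¹ * (M * ((Finset.univ.filter (r k)).card * ‖v i‖))) fun l => by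
      rw [inv_mul_eq_div, le_div_iff₀ h0, mul_comm]
      exact hone l
    have h3 : ∑ l with r i l, ‖z‖⁻¹ * (M * ((Finset.univ.filter (r l)).card * ‖v i‖)) =
        ‖z‖⁻¹ * M * ‖v i‖ * ∑ l with r i l, ((Finset.univ.filter (r l)).card : ℝ) := by
      rw [Finset.mul_sum]
      exact Finset.sum_congr rfl fun l _ => by ring
    rw [h3] at h2
    have h4 : ‖z‖ * ‖v i‖ ≤ M * (‖z‖⁻¹ * M * ‖v i‖ * (J : ℝ) ^ 2) := by
      refine h2.trans ?_
      gcongr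
      exact hr i
    have h5 : ‖z‖ ≤ M * M * (J : ℝ) ^ 2 * ‖z‖⁻¹ := by
      refine le_of_mul_le_mul_right (h4.trans (le_of_eq ?_)) hpos
      ring
    rw [← div_eq_mul_inv, le_div_iff₀ h0] at h5
    nlinarith
  have hle : ‖z‖ ≤ (J : ℝ) * M := le_of_sq_le_sq hsq (by positivity)
  rw [← ENNReal.coe_mul]
  exact ENNReal.coe_le_coe.2 (by exact_mod_cast hle)

/-! ### Asymptotics of the Chernoff bounds -/

lemma log_factorial_le {j : ℕ} (hj : 1 ≤ j) :
    Real.log (j.factorial) ≤ 1 + Real.log j / 2 + j * Real.log j - j := by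
  obtain ⟨m, rfl⟩ : ∃ m, j = m + 1 := ⟨j - 1, by omega⟩
  have h := Stirling.log_stirlingSeq'_antitone (Nat.zero_le m)
  simp only [Function.comp, Nat.succ_eq_add_one] at h
  rw [Stirling.log_stirlingSeq_formula, zero_add, Stirling.stirlingSeq_one,
    Real.log_div (Real.exp_pos 1).ne' (by positivity), Real.log_exp,
    Real.log_sqrt (by norm_num)] at h
  have hm : (0 : ℝ) < ((m + 1 : ℕ) : ℝ) := by positivity
  rw [Real.log_mul two_ne_zero hm.ne', Real.log_div hm.ne' (Real.exp_pos 1).ne', Real.log_exp] at h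
  nlinarith

lemma mul_log_sub_le_log_factorial (j : ℕ) :
    j * Real.log j - j ≤ Real.log (j.factorial) := by
  rcases Nat.eq_zero_or_pos j with rfl | hj
  · simp
  have h := Stirling.le_log_factorial_stirling hj.ne'
  have h1 : 0 ≤ Real.log j := Real.log_natCast_nonneg j
  have h2 : 0 ≤ Real.log (2 * Real.pi) := Real.log_nonneg (by linarith [Real.pi_gt_three])
  linarith

/-- The common majorant, up to a constant, of the probabilities of the exceptional events. The first
factor bounds the number `n` of points in terms of the Poisson level `j`; the second is a Chernoff
bound, with weight `j / g` per point, at the threshold `j + β * j / log j`. -/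
noncomputable def levelBound (g c β K : ℝ) (j : ℕ) : ℝ :=
  Real.exp g * ((j + 1).factorial / g ^ (j + 1)) *
    ((j / g) ^ (2 - j - β * (j / Real.log j)) * Real.exp (c * j + K * √j))

/-- By Stirling's formula `log (levelBound g c β K j) = (c - 1 - β) * j + o(j)`: moving the
threshold by `β * j / log j` is worth the exponential factor `exp (-β * j)`. -/
lemma tendsto_levelBound {g c β : ℝ} (hg : 0 < g) (K : ℝ) (h : c - 1 < β) :
    Tendsto (levelBound g c β K) atTop (𝓝 0) := by
  set A : ℝ := g + 2 + |Real.log g| * 3 with hA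
  set Φ : ℝ → ℝ := fun x => (c - 1 - β) + (A / x + 5 * (Real.log x / x)
    + β * Real.log g * (Real.log x)⁻¹ + K * (1 / √x)) with hΦ
  have hΦlim : Tendsto Φ atTop (𝓝 ((c - 1 - β) + (0 + 5 * 0 + β * Real.log g * 0 + K * 0))) := by
    refine tendsto_const_nhds.add (((Tendsto.add ?_ ?_).add ?_).add ?_)
    · exact tendsto_const_nhds.div_atTop tendsto_id
    · exact (Real.isLittleO_log_id_atTop.tendsto_div_nhds_zero).const_mul 5
    · exact (tendsto_inv_atTop_zero.comp Real.tendsto_log_atTop).const_mul _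
    · exact (tendsto_const_nhds.div_atTop Real.tendsto_sqrt_atTop).const_mul K
  have hexp : Tendsto (fun j : ℕ => Real.exp ((j : ℝ) * Φ j)) atTop (𝓝 0) := by
    refine Real.tendsto_exp_atBot.comp (Tendsto.atTop_mul_neg (C := c - 1 - β) (by linarith)
      tendsto_natCast_atTop_atTop ?_)
    simpa [Function.comp_def] using hΦlim.comp (tendsto_natCast_atTop_atTop (R := ℝ))
  refine squeeze_zero' (Eventually.of_forall fun j => by unfold levelBound; positivity) ?_ hexp
  filter_upwards [eventually_ge_atTop 2] with j hj
  have hj2 : (2 : ℝ) ≤ j := by exact_mod_cast hj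
  have hj0 : (0 : ℝ) < j := by linarith
  have hL : 0 < Real.log j := Real.log_pos (by linarith)
  rw [levelBound, ← Real.log_le_iff_le_exp (by positivity),
    Real.log_mul (by positivity) (by positivity),
    Real.log_mul (by positivity) (by positivity), Real.log_mul (by positivity) (by positivity),
    Real.log_div (by positivity) (by positivity), Real.log_rpow (by positivity),
    Real.log_div hj0.ne' hg.ne', Real.log_exp, Real.log_exp, Real.log_pow]
  have hfac : Real.log ((j + 1).factorial) ≤
      2 + 2 * Real.log j + (j * Real.log j - j) := by
    rw [Nat.factorial_succ, Nat.cast_mul, Real.log_mul (by positivity) (by positivity)]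
    have h1 := log_factorial_le (j := j) (by omega)
    have h2 : Real.log ((j + 1 : ℕ) : ℝ) ≤ 1 + Real.log j := by
      rw [← Real.log_exp 1, ← Real.log_mul (Real.exp_pos 1).ne' hj0.ne']
      refine Real.log_le_log (by positivity) ?_
      push_cast
      nlinarith [Real.add_one_le_exp 1]
    linarith
  have hsqrt : (j : ℝ) * (1 / √j) = √j := by
    rw [mul_one_div, Real.div_sqrt]
  have e1 : (j : ℝ) * Φ j = (c - 1 - β) * j + (A + 5 * Real.log j
      + β * Real.log g * (j / Real.log j) + K * √j) := by
    rw [← hsqrt, hΦ]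
    field_simp
  have e2 : j / Real.log j * Real.log j = (j : ℝ) := by field_simp
  rw [e1]
  push_cast
  have h3 := neg_abs_le (Real.log g)
  have e3 : (2 - (j : ℝ) - β * (j / Real.log j)) * (Real.log j - Real.log g) =
      2 * Real.log j - 2 * Real.log g - j * Real.log j + j * Real.log g
        - β * (j / Real.log j * Real.log j) + β * Real.log g * (j / Real.log j) := by ring
  rw [e3, e2]
  linarith

/-! ### The Poisson level -/

lemma poissonMeasure_Ici_le (γ : ℝ≥0) (k : ℕ) :
    poissonMeasure γ (Set.Ici k) ≤ ENNReal.ofReal ((γ : ℝ) ^ k / k.factorial) := by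
  have hU : Set.Ici k = ⋃ i : ℕ, {i + k} := by
    ext m
    simp only [Set.mem_Ici, Set.mem_iUnion, Set.mem_singleton_iff]
    exact ⟨fun h => ⟨m - k, by omega⟩, by rintro ⟨i, rfl⟩; omega⟩
  have hterm : ∀ i : ℕ, poissonMeasure γ {i + k} ≤
      ENNReal.ofReal ((γ : ℝ) ^ k / k.factorial) *
        ENNReal.ofReal (Real.exp (-γ) * (γ : ℝ) ^ i / i.factorial) := by
    intro i
    rw [poissonMeasure_singleton, ← ENNReal.ofReal_mul (by positivity)]
    refine ENNReal.ofReal_le_ofReal ?_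
    have hfac : ((k.factorial * i.factorial : ℕ) : ℝ) ≤ (i + k).factorial := by
      rw [mul_comm]
      exact_mod_cast Nat.le_of_dvd (Nat.factorial_pos _)
        (Nat.factorial_mul_factorial_dvd_factorial_add i k)
    calc Real.exp (-γ) * (γ : ℝ) ^ (i + k) / (i + k).factorial
        ≤ Real.exp (-γ) * (γ : ℝ) ^ (i + k) / ((k.factorial * i.factorial : ℕ) : ℝ) := by
          gcongr
      _ = _ := by
          push_cast
          rw [pow_add]
          field_simp
  rw [hU]
  refine (measure_iUnion_le _).trans ((ENNReal.tsum_le_tsum hterm).trans ?_)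
  rw [ENNReal.tsum_mul_left, ← ENNReal.ofReal_tsum_of_nonneg (fun i => by positivity)
    (hasSum_one_poissonMeasure γ).summable, (hasSum_one_poissonMeasure γ).tsum_eq]
  simp

lemma IsPoissonLevel.unique {γ : ℝ≥0} {n k l : ℕ} (hk : IsPoissonLevel γ n k)
    (hl : IsPoissonLevel γ n l) : k = l := by
  have aux : ∀ {k l : ℕ}, IsPoissonLevel γ n k → IsPoissonLevel γ n l → ¬ k < l := by
    intro k l hk hl hkl
    refine absurd hl.2 (not_lt.2 (le_trans ?_ hk.1))
    gcongr
    exact hkl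
  have h1 := aux hk hl
  have h2 := aux hl hk
  omega

lemma existsUnique_isPoissonLevel (γ : ℝ≥0) {n : ℕ} (hn : 2 ≤ n) :
    ∃! k, IsPoissonLevel γ n k := by
  have hex : ∃ k, (n : ℝ≥0∞) * poissonMeasure γ (Set.Ici (k + 1)) ≤ 1 := by
    have h0 : Tendsto (fun k : ℕ => (n : ℝ≥0∞) * ENNReal.ofReal ((γ : ℝ) ^ k / k.factorial)) atTop
        (𝓝 ((n : ℝ≥0∞) * ENNReal.ofReal 0)) :=
      ENNReal.Tendsto.const_mul (ENNReal.tendsto_ofReal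
        (FloorSemiring.tendsto_pow_div_factorial_atTop (γ : ℝ))) (Or.inr (ENNReal.natCast_ne_top n))
    rw [ENNReal.ofReal_zero, mul_zero] at h0
    obtain ⟨k, hk⟩ :=
      ((tendsto_add_atTop_iff_nat 1).2 h0 |>.eventually (gt_mem_nhds one_pos)).exists
    exact ⟨k, (mul_le_mul_right (poissonMeasure_Ici_le γ (k + 1)) _).trans hk.le⟩
  classical
  -- The level is the least `k` with `n * P (Po γ ≥ k + 1) ≤ 1`; for `k = 0` the other half of the
  -- definition is `1 < n`.
  refine ⟨Nat.find hex, ⟨Nat.find_spec hex, ?_⟩,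
    fun l hl => IsPoissonLevel.unique hl ⟨Nat.find_spec hex, ?_⟩⟩
  all_goals
    rcases h : Nat.find hex with _ | k
    · have : Set.Ici 0 = (Set.univ : Set ℕ) := by ext; simp
      rw [this, measure_univ, mul_one]
      exact_mod_cast hn
    · exact not_le.1 (Nat.find_min hex (by omega))

lemma IsPoissonLevel.natCast_le {γ : ℝ≥0} (hγ : 0 < γ) {n k : ℕ} (h : IsPoissonLevel γ n k) :
    (n : ℝ) ≤ Real.exp γ * ((k + 1).factorial / (γ : ℝ) ^ (k + 1)) := by
  have hγ' : (0 : ℝ) < γ := hγ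
  have h1 : (n : ℝ≥0∞) * ENNReal.ofReal
      (Real.exp (-γ) * (γ : ℝ) ^ (k + 1) / (k + 1).factorial) ≤ 1 := by
    rw [← poissonMeasure_singleton]
    refine le_trans ?_ h.1
    gcongr
    simp
  rw [← ENNReal.ofReal_natCast, ← ENNReal.ofReal_mul (by positivity), ENNReal.ofReal_le_one] at h1
  rw [Real.exp_neg] at h1
  have hpos : 0 < Real.exp γ * ((k + 1).factorial / (γ : ℝ) ^ (k + 1)) := by positivity
  calc (n : ℝ) = (n * ((Real.exp γ)⁻¹ * (γ : ℝ) ^ (k + 1) / (k + 1).factorial)) *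
        (Real.exp γ * ((k + 1).factorial / (γ : ℝ) ^ (k + 1))) := by field_simp
    _ ≤ _ := mul_le_of_le_one_left hpos.le h1

lemma IsPoissonLevel.one_lt {γ : ℝ≥0} {n k : ℕ} (h : IsPoissonLevel γ n k) :
    1 < (n : ℝ) * ((γ : ℝ) ^ k / k.factorial) := by
  have h1 := h.2.trans_le (mul_le_mul_right (poissonMeasure_Ici_le γ k) _)
  rwa [← ENNReal.ofReal_natCast, ← ENNReal.ofReal_mul (by positivity), ENNReal.one_lt_ofReal] at h1

lemma tendsto_isPoissonLevel_atTop {γ : ℝ≥0} (hγ : 0 < γ) {j : ℕ → ℕ}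
    (hj : ∀ n, 2 ≤ n → IsPoissonLevel γ n (j n)) : Tendsto j atTop atTop := by
  refine tendsto_atTop.2 fun b => ?_
  have hγ' : (0 : ℝ) < γ := hγ
  -- Each level `k < b` is possible only for boundedly many `n`.
  set C : ℝ := ∑ k ∈ Finset.range b, Real.exp γ * ((k + 1).factorial / (γ : ℝ) ^ (k + 1))
  filter_upwards [eventually_ge_atTop 2,
    (tendsto_natCast_atTop_atTop (R := ℝ)).eventually_gt_atTop C] with n hn hC
  by_contra! hlt
  refine absurd ((hj n hn).natCast_le hγ) (not_le.2 (lt_of_le_of_lt ?_ hC))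
  exact Finset.single_le_sum
    (f := fun k : ℕ => Real.exp γ * ((k + 1).factorial / (γ : ℝ) ^ (k + 1)))
    (fun k _ => by positivity) (Finset.mem_range.2 hlt)

lemma eventually_isPoissonLevel_le {γ : ℝ≥0} (hγ : 0 < γ) {j : ℕ → ℕ}
    (hj : ∀ n, 2 ≤ n → IsPoissonLevel γ n (j n)) :
    ∀ᶠ n : ℕ in atTop, (j n : ℝ) ≤ 3 * Real.log n / Real.log (Real.log n) := by
  have hγ' : (0 : ℝ) < γ := hγ
  have hlog : Tendsto (fun n : ℕ => Real.log n) atTop atTop :=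
    Real.tendsto_log_atTop.comp tendsto_natCast_atTop_atTop
  have hloglog := Real.tendsto_log_atTop.comp hlog
  have hsmall := hlog.eventually
    ((isLittleO_log_rpow_atTop (r := 1 / 2) (by norm_num)).bound one_pos)
  set C : ℝ := 1 + Real.log γ with hC
  filter_upwards [eventually_ge_atTop 2, hlog.eventually_gt_atTop 1, hsmall,
    hloglog.eventually_ge_atTop (6 * |C| + 1)] with n hn hN hs hl
  simp only [Function.comp] at hl
  set N := Real.log n
  set l := Real.log N with hldef
  have hN0 : 0 < N := by linarith
  have hl0 : 0 < l := by linarith [abs_nonneg C]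
  by_contra! hlt
  have hq0 : 0 < 3 * N / l := by positivity
  have hj0 : (0 : ℝ) < j n := hq0.trans hlt
  -- `j log (j / (e γ)) < log n`, from `j! / γ ^ j < n`
  have hup : (j n : ℝ) * (Real.log (j n) - C) < N := by
    have h1 := Real.log_pos (hj n hn).one_lt
    have hn0 : (0 : ℝ) < n := by exact_mod_cast (by omega : 0 < n)
    rw [Real.log_mul (by positivity) (by positivity), Real.log_div (by positivity) (by positivity),
      Real.log_pow] at h1
    have := mul_log_sub_le_log_factorial (j n)
    rw [hC]
    nlinarith
  have hsqrt : l ≤ N ^ (1 / 2 : ℝ) := by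
    have := hs
    rw [one_mul, Real.norm_of_nonneg hl0.le, Real.norm_of_nonneg (by positivity)] at this
    exact this
  have hlogj : l / 2 ≤ Real.log (j n) := by
    have : N ^ (1 / 2 : ℝ) ≤ j n := by
      refine le_trans ?_ hlt.le
      rw [le_div_iff₀ hl0]
      calc N ^ (1 / 2 : ℝ) * l ≤ N ^ (1 / 2 : ℝ) * N ^ (1 / 2 : ℝ) := by gcongr
        _ = N := by rw [← Real.rpow_add hN0]; norm_num
        _ ≤ 3 * N := by linarith
    have h2 := Real.log_le_log (by positivity) this
    rw [Real.log_rpow hN0] at h2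
    linarith
  have h3 : l / 3 ≤ Real.log (j n) - C := by linarith [le_abs_self C]
  have h4 : 3 * N / l * (l / 3) ≤ j n * (Real.log (j n) - C) :=
    mul_le_mul hlt.le h3 (by positivity) hj0.le
  have h5 : 3 * N / l * (l / 3) = N := by field_simp
  linarith

/-! ### Exceptional events -/

lemma measure_exists_le_card_mul {Ω : Type*} [MeasurableSpace Ω] (ν : Measure Ω) {ι : Type*}
    [Fintype ι] (A : ι → Set Ω) {b : ℝ} (hA : ∀ i, ν (A i) ≤ ENNReal.ofReal b) :
    ν {x | ∃ i, x ∈ A i} ≤ ENNReal.ofReal (Fintype.card ι * b) := by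
  have : {x | ∃ i, x ∈ A i} = ⋃ i, A i := by ext; simp
  rw [this]
  refine (measure_iUnion_fintype_le _ _).trans ((Finset.sum_le_sum fun i _ => hA i).trans ?_)
  rw [Finset.sum_const, Finset.card_univ, nsmul_eq_mul, ENNReal.ofReal_mul (by positivity),
    ENNReal.ofReal_natCast]

section Exceptional

variable {d n j : ℕ} {μ : Measure (Fin d → ℝ)} [IsProbabilityMeasure μ] {δ g ε κ : ℝ}

/-- No window holds substantially more points than the Poisson level: the Chernoff bound with weight
`T = j / g`. -/
lemma measure_exists_windowCount_ge_le (hd : 2 ≤ d) (hμ : μ ≤ volume) (hδ : 0 < δ) (hg : 0 < g)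
    (hgj : g ≤ j) (hn : (n : ℝ) ≤ Real.exp g * ((j + 1).factorial / g ^ (j + 1)))
    (hr : n * δ ^ d ≤ 1001 / 1000 * g) (hε : ε = κ / Real.log j) :
    Measure.pi (fun _ : Fin n => μ) {x | ∃ i, (1 + ε) * j ≤ windowCount δ x i} ≤
      ENNReal.ofReal (levelBound g (1001 / 1000) κ 0 j) := by
  have hj0 : (0 : ℝ) < j := hg.trans_le hgj
  have hT : 1 ≤ j / g := (one_le_div hg).2 hgj
  refine (measure_exists_le_card_mul _ (fun i => {x | (1 + ε) * j ≤ windowCount δ x i})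
    (b := (j / g) ^ (2 - j - κ * (j / Real.log j)) * Real.exp (1001 / 1000 * j + 0 * √j))
    fun i => ?_).trans ?_
  · refine (measure_mono fun x hx => ?_).trans ((measure_windowCount_ge_le μ hd hμ hδ hT le_rfl
      ((1 + ε) * j) 0 i).trans (ENNReal.ofReal_le_ofReal ?_))
    · exact ⟨hx, by positivity⟩
    rw [Real.one_rpow, mul_one, mul_one]
    gcongr ?_ * Real.exp ?_
    · nth_rw 2 [← Real.rpow_one (j / g)]
      rw [← Real.rpow_add (by positivity)]
      refine Real.rpow_le_rpow_of_exponent_le hT (le_of_sub_nonneg (le_of_le_of_eq zero_le_one ?_))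
      rw [hε]
      ring
    · calc n * (j / g * δ ^ d + j / g * (1 - 1) * (δ ^ d / 4)) = j / g * (n * δ ^ d) := by ring
        _ ≤ j / g * (1001 / 1000 * g) := by gcongr
        _ = _ := by field_simp; ring
  · rw [Fintype.card_fin, levelBound]
    gcongr

/-- No two neighbouring points whose windows hold many points are far from each other. The weight
`T = √(j / g)` gives `j / g` on the overlap of the two windows, of volume at most
`3 / 4 * δ ^ d`. -/
lemma measure_exists_pair_le (hμ : μ ≤ volume) (hδ : 0 < δ) (hg : 0 < g)
    (hgj : g ≤ j) (hn : (n : ℝ) ≤ Real.exp g * ((j + 1).factorial / g ^ (j + 1)))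
    (hr : n * δ ^ d ≤ 1001 / 1000 * g) (hε : ε = κ / Real.log j) :
    Measure.pi (fun _ : Fin n => μ) {x | ∃ q : Fin n × Fin n, x q.2 ∈ window δ (x q.1) ∧
        x q.2 ∉ window (δ / 2) (x q.1) ∧ (1 - 3 * ε) * j ≤ windowCount δ x q.1 ∧
        (1 - 3 * ε) * j ≤ windowCount δ x q.2} ≤
      ENNReal.ofReal (1001 / 1000 * g *
        levelBound g (3 / 4 * (1001 / 1000)) (-(3 * κ)) (2 * (1001 / 1000 * g) / √g) j) := by
  have hj0 : (0 : ℝ) < j := hg.trans_le hgj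
  have hT : 1 ≤ √(j / g) := Real.one_le_sqrt.2 ((one_le_div hg).2 hgj)
  have hT2 : √(j / g) ^ 2 = j / g := Real.sq_sqrt (by positivity)
  set R : ℝ := (j / g) ^ (2 - j - -(3 * κ) * (j / Real.log j)) *
    Real.exp (3 / 4 * (1001 / 1000) * j + 2 * (1001 / 1000 * g) / √g * √j) with hR
  refine (measure_exists_le_card_mul _ (fun q : Fin n × Fin n =>
    {x | x q.2 ∈ window δ (x q.1) ∧ x q.2 ∉ window (δ / 2) (x q.1) ∧
      (1 - 3 * ε) * j ≤ windowCount δ x q.1 ∧ (1 - 3 * ε) * j ≤ windowCount δ x q.2})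
    (b := δ ^ d * R) fun q => ?_).trans ?_
  · refine (measure_pair_windowCount_ge_le μ hμ hδ hT _ q.1 q.2).trans
      (ENNReal.ofReal_le_ofReal ?_)
    rw [mul_assoc, hR]
    gcongr ?_ * (?_ * Real.exp ?_)
    · refine le_of_eq ?_
      have h4 : √(j / g) ^ 4 = (j / g) ^ (2 : ℝ) := by
        rw [show √(j / g) ^ 4 = (√(j / g) ^ 2) ^ 2 by ring, hT2, Real.rpow_two]
      rw [h4, ← Real.mul_rpow (by positivity) (by positivity), ← sq, hT2,
        ← Real.rpow_add (by positivity), hε]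
      congr 1
      ring
    · calc n * (√(j / g) ^ 2 * (3 / 4 * δ ^ d) + √(j / g) * (2 * δ ^ d))
          = (3 / 4 * (j / g) + 2 * √(j / g)) * (n * δ ^ d) := by rw [hT2]; ring
        _ ≤ (3 / 4 * (j / g) + 2 * √(j / g)) * (1001 / 1000 * g) := by gcongr
        _ = _ := by
          rw [Real.sqrt_div hj0.le]
          field_simp
  · rw [Fintype.card_prod, Fintype.card_fin, levelBound]
    refine ENNReal.ofReal_le_ofReal ?_
    push_cast
    calc (n : ℝ) * n * (δ ^ d * R) = (n * δ ^ d) * (n * R) := by ring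
      _ ≤ (1001 / 1000 * g) * (Real.exp g * ((j + 1).factorial / g ^ (j + 1)) * R) := by
        gcongr

/-- In no window holding many points do half of the threshold number lie in the window of half the
side. The weights `T = j / (2 * g)` and `u = 4` combine at the thresholds `s` and `s / 2` to
`T ^ s * u ^ (s / 2) = (j / g) ^ s`, while the exponent is only `7 / 4 * T = 7 / 8 * (j / g)` per
unit of `n * δ ^ d`. -/
lemma measure_exists_windowCount_half_ge_le (hd : 2 ≤ d) (hμ : μ ≤ volume) (hδ : 0 < δ)
    (hg : 0 < g) (hgj : 2 * g ≤ j)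
    (hn : (n : ℝ) ≤ Real.exp g * ((j + 1).factorial / g ^ (j + 1)))
    (hr : n * δ ^ d ≤ 1001 / 1000 * g) (hε : ε = κ / Real.log j) :
    Measure.pi (fun _ : Fin n => μ) {x | ∃ i, (1 - 3 * ε) * j ≤ windowCount δ x i ∧
        (1 - 3 * ε) * j / 2 ≤ windowCount (δ / 2) x i} ≤
      ENNReal.ofReal (2 * levelBound g (7 / 8 * (1001 / 1000)) (-(3 * κ)) 0 j) := by
  have hj0 : (0 : ℝ) < j := (by positivity : 0 < 2 * g).trans_le hgj
  have hT : 1 ≤ j / g / 2 := by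
    rw [div_div, one_le_div (by positivity)]
    linarith
  refine (measure_exists_le_card_mul _ (fun i => {x | (1 - 3 * ε) * j ≤ windowCount δ x i ∧
      (1 - 3 * ε) * j / 2 ≤ windowCount (δ / 2) x i})
    (b := 2 * ((j / g) ^ (2 - j - -(3 * κ) * (j / Real.log j)) *
      Real.exp (7 / 8 * (1001 / 1000) * j + 0 * √j))) fun i => ?_).trans ?_
  · refine (measure_windowCount_ge_le μ hd hμ hδ hT (u := 4) (by norm_num) _ _ i).trans
      (ENNReal.ofReal_le_ofReal ?_)
    rw [← mul_assoc (2 : ℝ)]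
    gcongr ?_ * Real.exp ?_
    · have h4 : (4 : ℝ) ^ (-((1 - 3 * ε) * j / 2)) = 2 ^ (-((1 - 3 * ε) * j)) := by
        rw [show (4 : ℝ) = 2 ^ (2 : ℝ) by norm_num, ← Real.rpow_mul (by norm_num)]
        congr 1
        ring
      rw [h4, ← Real.mul_rpow (by positivity) (by positivity), div_mul_cancel₀ _ two_ne_zero]
      calc (j / g) ^ (-((1 - 3 * ε) * j)) * (j / g / 2 * 4)
          = 2 * ((j / g) ^ (-((1 - 3 * ε) * j)) * (j / g) ^ (1 : ℝ)) := by
            rw [Real.rpow_one]; ring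
        _ ≤ _ := by
            rw [← Real.rpow_add (by positivity)]
            gcongr ?_ * ?_
            refine Real.rpow_le_rpow_of_exponent_le (by linarith)
              (le_of_sub_nonneg (le_of_le_of_eq zero_le_one ?_))
            rw [hε]
            ring
    · calc n * (j / g / 2 * δ ^ d + j / g / 2 * (4 - 1) * (δ ^ d / 4))
          = 7 / 8 * (j / g) * (n * δ ^ d) := by ring
        _ ≤ 7 / 8 * (j / g) * (1001 / 1000 * g) := by gcongr
        _ = _ := by field_simp; ring
  · rw [Fintype.card_fin, levelBound]
    refine ENNReal.ofReal_le_ofReal ?_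
    rw [mul_left_comm]
    gcongr

end Exceptional

/-! ### The spectral radius of the Euclidean random matrix -/

/-- The uniform law on the unit cube, written as a restriction since the cube has volume one. -/
lemma cond_unitCube_eq_restrict (d : ℕ) :
    ProbabilityTheory.cond volume (unitCube d) = volume.restrict (unitCube d) := by
  simp [ProbabilityTheory.cond, volume_unitCube]

/-- The deterministic part: outside the three exceptional events the spectral radius is at most
`j` times the supremum of `f`. -/
lemma spectralRadius_euclideanMatrix_le {d n j : ℕ} {f : (Fin d → ℝ) → ℂ}
    (hsupp : Function.support f ⊆ unitCube d) {δ ε : ℝ} {x : Fin n → Fin d → ℝ}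
    (hj : j ≠ 0) (hε : 0 ≤ ε) (hε1 : 3 * ε ≤ 1)
    (h1 : ∀ i, windowCount δ x i < (1 + ε) * j)
    (h2 : ∀ i k, x k ∈ window δ (x i) → (1 - 3 * ε) * j ≤ windowCount δ x i →
      (1 - 3 * ε) * j ≤ windowCount δ x k → x k ∈ window (δ / 2) (x i))
    (h3 : ∀ i, (1 - 3 * ε) * j ≤ windowCount δ x i →
      windowCount (δ / 2) x i < (1 - 3 * ε) * j / 2) :
    spectralRadius ℂ (euclideanMatrix f δ x) ≤ (j : ℝ≥0∞) * ⨆ z ∈ unitCube d, ‖f z‖ₑ := by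
  set F : ℝ≥0∞ := ⨆ z ∈ unitCube d, ‖f z‖ₑ with hF
  -- For unbounded `f` the right-hand side is infinite, as `j ≠ 0`.
  by_cases hFtop : F = ⊤
  · rw [hFtop, ENNReal.mul_top (by exact_mod_cast hj)]
    exact le_top
  have hle : ∀ z ∈ unitCube d, ‖f z‖ ≤ F.toNNReal := by
    intro z hz
    have h : ‖f z‖ₑ ≤ F := le_iSup₂ (f := fun z (_ : z ∈ unitCube d) => ‖f z‖ₑ) z hz
    rw [← ENNReal.coe_toNNReal hFtop, enorm_eq_nnnorm, ENNReal.coe_le_coe] at h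
    exact_mod_cast h
  have key := spectralRadius_le_of_sum_card_le (euclideanMatrix f δ x)
    (fun i k => x k ∈ window δ (x i)) (M := F.toNNReal) (J := j) ?_ ?_
  · rwa [ENNReal.coe_toNNReal hFtop, ENNReal.coe_natCast] at key
  · intro i k
    simp only [euclideanMatrix, Matrix.of_apply]
    split_ifs with h
    · exact hle _ h
    · rw [Function.notMem_support.1 fun h' => h (hsupp h'), norm_zero]
  · intro i
    have := sum_windowCount_le (Nat.cast_nonneg j) hε hε1 h1 h2 h3 i
    simpa only [windowCount, NNReal.coe_natCast] using this

lemma tendsto_measure_one_of_compl_le {S : ℕ → Type*} [∀ n, MeasurableSpace (S n)]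
    (P : ∀ n, Measure (S n)) [∀ n, IsProbabilityMeasure (P n)] {A : ∀ n, Set (S n)}
    {b : ℕ → ℝ≥0∞} (hb : Tendsto b atTop (𝓝 0)) (h : ∀ᶠ n in atTop, P n (A n)ᶜ ≤ b n) :
    Tendsto (fun n => P n (A n)) atTop (𝓝 1) := by
  have h1 : Tendsto (fun n => 1 - b n) atTop (𝓝 (1 - 0)) :=
    ENNReal.Tendsto.sub tendsto_const_nhds hb (Or.inl ENNReal.one_ne_top)
  rw [tsub_zero] at h1
  refine tendsto_of_tendsto_of_tendsto_of_le_of_le' h1 tendsto_const_nhds ?_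
    (Eventually.of_forall fun n => prob_le_one)
  filter_upwards [h] with n hn
  rw [tsub_le_iff_right, ← measure_univ (μ := P n), ← Set.union_compl_self (A n)]
  exact (measure_union_le _ _).trans (add_le_add_right hn _)

lemma tendsto_measure_spectralRadius_le {d : ℕ} (hd : 2 ≤ d) {γ : ℝ≥0} (hγ : 0 < γ)
    {f : (Fin d → ℝ) → ℂ} (hsupp : Function.support f ⊆ unitCube d)
    {δ : ℕ → ℝ} (hδ : ∀ n, 1 ≤ n → 0 < δ n)
    (hδγ : Tendsto (fun n : ℕ => δ n ^ d * (n : ℝ)) atTop (𝓝 (γ : ℝ)))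
    {S : ℕ → Type*} [∀ n, MeasurableSpace (S n)]
    (P : ∀ n, Measure (S n)) [∀ n, IsProbabilityMeasure (P n)]
    {X : ∀ n, Fin n → S n → (Fin d → ℝ)}
    (hX : ∀ n i, Measurable (X n i))
    (hindep : ∀ n, iIndepFun (X n) (P n))
    (hunif : ∀ n i, pdf.IsUniform (X n i) (unitCube d) (P n) volume)
    {j : ℕ → ℕ} (hj : ∀ n, 2 ≤ n → IsPoissonLevel γ n (j n)) :
    Tendsto (fun n => P n {s |
      spectralRadius ℂ (euclideanMatrix f (δ n) (fun i => X n i s)) ≤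
        (j n : ℝ≥0∞) * ⨆ x ∈ unitCube d, ‖f x‖ₑ}) atTop (𝓝 1) := by
  have hγ' : (0 : ℝ) < γ := hγ
  have hjtop := tendsto_isPoissonLevel_atTop hγ hj
  have hjtop' : Tendsto (fun n => (j n : ℝ)) atTop atTop := tendsto_natCast_atTop_atTop.comp hjtop
  set μ : Measure (Fin d → ℝ) := volume.restrict (unitCube d) with hμdef
  have hμ : μ ≤ volume := Measure.restrict_le_self
  have : IsProbabilityMeasure μ := ⟨by simp [hμdef, volume_unitCube]⟩
  have hmap : ∀ n, (P n).map (fun s i => X n i s) = Measure.pi fun _ => μ := by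
    intro n
    rw [(iIndepFun_iff_map_fun_eq_pi_map fun i => (hX n i).aemeasurable).1 (hindep n)]
    congr 1
    funext i
    rw [(hunif n i : (P n).map (X n i) = _), cond_unitCube_eq_restrict]
  set g : ℝ := (γ : ℝ) with hg
  -- The constant `κ = 1 / 100` is small against the gains `1 / 4` and `1 / 8` of the geometric
  -- constraints, and `1 / 1000`, the relative error allowed in `n * δ ^ d`, is small against `κ`.
  set b : ℕ → ℝ≥0∞ := fun n =>
    ENNReal.ofReal (levelBound g (1001 / 1000) (1 / 100) 0 (j n)) +
    ENNReal.ofReal (1001 / 1000 * g * levelBound g (3 / 4 * (1001 / 1000)) (-(3 * (1 / 100)))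
      (2 * (1001 / 1000 * g) / √g) (j n)) +
    ENNReal.ofReal (2 * levelBound g (7 / 8 * (1001 / 1000)) (-(3 * (1 / 100))) 0 (j n)) with hb
  have hlim : ∀ {c β : ℝ} (a K : ℝ), c - 1 < β →
      Tendsto (fun n => ENNReal.ofReal (a * levelBound g c β K (j n))) atTop (𝓝 0) := by
    intro c β a K h
    have := ((tendsto_levelBound hγ' K h).comp hjtop).const_mul a
    simpa [Function.comp_def] using ENNReal.tendsto_ofReal this
  have hb0 : Tendsto b atTop (𝓝 0) := by
    have e1 := hlim (c := 1001 / 1000) (β := 1 / 100) 1 0 (by norm_num)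
    simp only [one_mul] at e1
    simpa only [add_zero] using (e1.add (hlim (1001 / 1000 * g) (2 * (1001 / 1000 * g) / √g)
      (by norm_num : 3 / 4 * (1001 / 1000) - 1 < -(3 * (1 / 100 : ℝ))))).add
      (hlim 2 0 (by norm_num : 7 / 8 * (1001 / 1000) - 1 < -(3 * (1 / 100 : ℝ))))
  refine tendsto_measure_one_of_compl_le P hb0 ?_
  filter_upwards [eventually_ge_atTop 2, hjtop.eventually_ge_atTop 3,
    hjtop'.eventually_ge_atTop (2 * g),
    hδγ.eventually (ge_mem_nhds (show g < 1001 / 1000 * g by linarith))] with n hn hj3 hjg hr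
  rw [mul_comm] at hr
  have hδn := hδ n (by omega)
  have hnle := (hj n hn).natCast_le hγ
  set ε : ℝ := 1 / 100 / Real.log (j n) with hε
  have hlog : 1 ≤ Real.log (j n) := by
    rw [Real.le_log_iff_exp_le (by positivity)]
    have : (3 : ℝ) ≤ j n := by exact_mod_cast hj3
    linarith [Real.exp_one_lt_d9]
  have hε0 : 0 ≤ ε := by positivity
  have hε1 : 3 * ε ≤ 1 := by
    have : ε ≤ 1 / 100 := div_le_self (by norm_num) hlog
    linarith
  have b1 := measure_exists_windowCount_ge_le (n := n) hd hμ hδn hγ' (by linarith) hnle hr hε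
  have b2 := measure_exists_pair_le (n := n) hμ hδn hγ' (by linarith) hnle hr hε
  have b3 := measure_exists_windowCount_half_ge_le (n := n) hd hμ hδn hγ' hjg hnle hr hε
  refine le_trans ?_ (add_le_add (add_le_add b1 b2) b3)
  refine le_trans ?_ ((measure_union_le _ _).trans (add_le_add_left (measure_union_le _ _) _))
  rw [← hmap n]
  refine le_trans (measure_mono fun s hs => ?_)
    (Measure.le_map_apply (measurable_pi_lambda _ fun i => hX n i).aemeasurable _)
  by_contra hgood
  refine hs (spectralRadius_euclideanMatrix_le hsupp (by omega) hε0 hε1 ?_ ?_ ?_)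
  · intro i
    by_contra! h
    exact hgood (Or.inl (Or.inl ⟨i, h⟩))
  · intro i k h h' h''
    by_contra hnot
    exact hgood (Or.inl (Or.inr ⟨(i, k), h, hnot, h', h''⟩))
  · intro i h
    by_contra! h'
    exact hgood (Or.inr ⟨i, h, h'⟩)

theorem mainTheorem4 {d : ℕ} (hd : 2 ≤ d) (γ : ℝ≥0) (hγ : 0 < γ)
    (f : (Fin d → ℝ) → ℂ) (hf : Measurable f) (hsupp : Function.support f ⊆ unitCube d)
    (δ : ℕ → ℝ) (hδ : ∀ n, 1 ≤ n → 0 < δ n)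
    (hδγ : Tendsto (fun n : ℕ => δ n ^ d * (n : ℝ)) atTop (𝓝 (γ : ℝ)))
    {S : ℕ → Type*} [∀ n, MeasurableSpace (S n)]
    (P : ∀ n, Measure (S n)) [∀ n, IsProbabilityMeasure (P n)]
    (X : ∀ n, Fin n → S n → (Fin d → ℝ))
    (hX : ∀ n i, Measurable (X n i))
    (hindep : ∀ n, iIndepFun (X n) (P n))
    (hunif : ∀ n i, pdf.IsUniform (X n i) (unitCube d) (P n) volume) :
    (∀ n, 2 ≤ n → ∃! k, IsPoissonLevel γ n k) ∧
    ∀ j : ℕ → ℕ, (∀ n, 2 ≤ n → IsPoissonLevel γ n (j n)) →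
      Tendsto (fun n => P n {s |
          spectralRadius ℂ (euclideanMatrix f (δ n) (fun i => X n i s)) ≤
            (j n : ℝ≥0∞) * ⨆ x ∈ unitCube d, ‖f x‖ₑ}) atTop (𝓝 1) ∧
      (∀ᶠ n : ℕ in atTop, (j n : ℝ) ≤ 3 * Real.log n / Real.log (Real.log n)) ∧
      Tendsto (fun n => P n {s |
          spectralRadius ℂ (euclideanMatrix f (δ n) (fun i => X n i s)) ≤
            ENNReal.ofReal (3 * Real.log n / Real.log (Real.log n)) *
              ⨆ x ∈ unitCube d, ‖f x‖ₑ}) atTop (𝓝 1) := by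
  refine ⟨fun n hn => existsUnique_isPoissonLevel γ hn, fun j hj => ?_⟩
  have h1 := tendsto_measure_spectralRadius_le hd hγ hsupp hδ hδγ P hX hindep hunif hj
  have h2 := eventually_isPoissonLevel_le hγ hj
  refine ⟨h1, h2, tendsto_of_tendsto_of_tendsto_of_le_of_le' h1 tendsto_const_nhds ?_
    (Eventually.of_forall fun n => prob_le_one)⟩
  filter_upwards [h2] with n hn
  refine measure_mono fun s hs => le_trans (Set.mem_ofPred_eq ▸ hs) ?_
  gcongr
  rw [← ENNReal.ofReal_natCast]
  exact ENNReal.ofReal_le_ofReal hn
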